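/- Let $d\ge 0$ be an integer and let $\mathcal F\subseteq L^2(\mathbb R^d)$ be a set of (complex-valued) functions such that $\sup_{f\in\mathcal F}\|f\|_2\le M<\infty$. Suppose that $$\lim_{r\to\infty}\ \sup_{f\in\mathcal F}\int_{|x|\ge r}|f(x)|^2\,dx=0\qquad\text{and}\qquad \lim_{\rho\to\infty}\ \sup_{f\in\mathcal F}\int_{|\xi|\ge\rho}|\hat f(\xi)|^2\,d\xi=0,$$ where $\hat f$ is the Fourier transform of $f$ on $L^2(\mathbb R^d)$, i.e. the continuous extension to $L^2(\mathbb R^d)$ of $\hat f(\xi)=(2\pi)^{-d/2}\int_{\mathbb R^d}f(x)e^{-i x\cdot\xi}\,dx$ (suprema over the empty set being $0$). Then $\mathcal F$ is totally bounded in $L^2(\mathbb R^d)$. -/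

import Mathlib

open MeasureTheory Filter Topology
open scoped FourierTransform ENNReal

/-- The Fourier transform on `L²(ℝᵈ)` in the unitary angular-frequency normalization,
`f̂(ξ) = (2π)^(-d/2) ∫ f(x) e^{-i x·ξ} dx` for nice `f`. It is obtained from Mathlib's
`L²` Fourier transform (the Plancherel extension of `∫ f(x) e^{-2πi x·η} dx` from Schwartz
functions) by the substitution `η = ξ / (2π)`. As a dilation preserves null sets, the result
is well defined up to equality almost everywhere. -/
noncomputable def fourierL2 {d : ℕ}
    (f : Lp ℂ 2 (volume : Measure (EuclideanSpace ℝ (Fin d)))) :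
    EuclideanSpace ℝ (Fin d) → ℂ :=
  fun ξ => (((2 * Real.pi) ^ (-(d : ℝ) / 2) : ℝ) : ℂ) *
    (𝓕 f : Lp ℂ 2 (volume : Measure (EuclideanSpace ℝ (Fin d)))) ((2 * Real.pi)⁻¹ • ξ)

/-! For `f, g ∈ F` put `u = f - g`. By Plancherel it suffices to make `𝓕 u` small in `L²`. High
frequencies are small by hypothesis. At low frequencies, split `u` at radius `R`: the outer part has
small norm by hypothesis, and the transform of the inner part at `ξ` is the inner product of `u`
with a truncated plane wave. Plane waves of bounded frequency form a compact subset of `L²`, so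
finitely many inner products control `‖u‖`, and a bounded `F` has totally bounded image under
finitely many functionals. -/

theorem totallyBounded_of_forall_inner {H : Type*} [NormedAddCommGroup H] [InnerProductSpace ℂ H]
    {F : Set H} {M : ℝ} (hM : ∀ f ∈ F, ‖f‖ ≤ M)
    (h : ∀ ε > 0, ∃ K : Set H, TotallyBounded K ∧ ∃ η > 0, ∀ f ∈ F, ∀ g ∈ F,
      (∀ e ∈ K, ‖inner ℂ e (f - g)‖ ≤ η) → dist f g < ε) :
    TotallyBounded F := by
  refine Metric.totallyBounded_iff.2 fun ε hε => ?_
  obtain ⟨K, hK, η, hη, hKη⟩ := h ε hε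
  set C : ℝ := 2 * (|M| + 1) with hC
  have hC0 : 0 < C := by positivity
  -- Since `‖f - g‖ ≤ C` on `F`, replacing `e ∈ K` by a nearby point of `t` costs at most `η / 2`;
  -- the net of `T '' F` supplies the other half.
  obtain ⟨t, ht, hKt⟩ := Metric.totallyBounded_iff.1 hK (η / (2 * C)) (by positivity)
  have := ht.fintype
  let T : H → t → ℂ := fun f e => inner ℂ (e : H) f
  have hTb : TotallyBounded (T '' F) := by
    refine (isCompact_closedBall (0 : t → ℂ) (∑ e : t, ‖(e : H)‖ * |M|)).totallyBounded.subset ?_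
    rintro _ ⟨f, hf, rfl⟩
    rw [mem_closedBall_zero_iff, pi_norm_le_iff_of_nonneg (by positivity)]
    intro e
    calc ‖T f e‖ ≤ ‖(e : H)‖ * ‖f‖ := norm_inner_le_norm _ _
      _ ≤ ‖(e : H)‖ * |M| := by gcongr; exact (hM f hf).trans (le_abs_self M)
      _ ≤ _ := Finset.single_le_sum (f := fun e : t => ‖(e : H)‖ * |M|)
        (fun _ _ => by positivity) (Finset.mem_univ e)
  obtain ⟨s, hsF, hs, hcov⟩ := totallyBounded_iff_subset.1 hTb _
    (Metric.dist_mem_uniformity (half_pos hη))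
  -- Lift the net to `F` with one preimage per point, which keeps it finite.
  obtain ⟨s', hs'F, hs', rfl⟩ : ∃ s' ⊆ F, s'.Finite ∧ T '' s' = s := by
    obtain ⟨u, hu, hus⟩ := Set.exists_subset_bijOn F T |>.imp fun _ h => h
    exact ⟨u ∩ T ⁻¹' s, Set.inter_subset_left.trans hu, by
      refine Set.Finite.of_finite_image (hs.subset (Set.image_subset_iff.2 Set.inter_subset_right))
        (hus.injOn.mono Set.inter_subset_left), by
      rw [Set.image_inter_preimage, hus.image_eq, Set.inter_eq_right.2 hsF]⟩
  refine ⟨s', hs', fun f hf => ?_⟩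
  obtain ⟨y, hy, hfy⟩ := Set.mem_iUnion₂.1 (hcov ⟨f, hf, rfl⟩)
  obtain ⟨g, hg, rfl⟩ := hy
  refine Set.mem_iUnion₂.2 ⟨g, hg, hKη f hf g (hs'F hg) fun e he => ?_⟩
  obtain ⟨e', he', hee'⟩ := Set.mem_iUnion₂.1 (hKt he)
  have h1 : ‖inner ℂ e' (f - g)‖ < η / 2 := by
    rw [inner_sub_right, ← dist_eq_norm]
    exact (dist_le_pi_dist (T f) (T g) ⟨e', he'⟩).trans_lt hfy
  have h2 : ‖inner ℂ (e - e') (f - g)‖ ≤ η / 2 := by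
    have hfg : ‖f - g‖ ≤ C := by
      have := norm_sub_le f g
      have := hM f hf
      have := hM g (hs'F hg)
      have := le_abs_self M
      linarith
    calc _ ≤ ‖e - e'‖ * ‖f - g‖ := norm_inner_le_norm _ _
      _ ≤ η / (2 * C) * C := by
        gcongr
        rw [← dist_eq_norm]; exact hee'.le
      _ = η / 2 := by field_simp
  calc _ = ‖inner ℂ (e - e') (f - g) + inner ℂ e' (f - g)‖ := by
        rw [← inner_add_left, sub_add_cancel]
    _ ≤ _ := norm_add_le _ _
    _ ≤ η := by linarith

section Fourier

variable {E : Type*} [NormedAddCommGroup E] [InnerProductSpace ℝ E] [FiniteDimensional ℝ E]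
  [MeasurableSpace E] [BorelSpace E]

-- Both sides have the same pairing with every test function, since the Fourier transform can be
-- moved onto the test function in either definition.
open scoped ContDiff SchwartzMap in
theorem Lp.fourier_ae_eq (h : Lp ℂ 2 (volume : Measure E)) (hi : Integrable h) :
    (𝓕 h : Lp ℂ 2 (volume : Measure E)) =ᵐ[volume] 𝓕 (h : E → ℂ) := by
  have hcont : Continuous (𝓕 (h : E → ℂ)) :=
    VectorFourier.fourierIntegral_continuous Real.continuous_fourierChar continuous_inner hi
  refine ae_eq_of_integral_contDiff_smul_eq
    ((Lp.memLp _).locallyIntegrable (by norm_num)) hcont.locallyIntegrable fun g hg hgc => ?_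
  have hg₁ : HasCompactSupport (Complex.ofRealCLM ∘ g) := hgc.comp_left rfl
  have hg₂ : ContDiff ℝ ∞ (Complex.ofRealCLM ∘ g) := by fun_prop
  set φ : 𝓢(E, ℂ) := hg₁.toSchwartzMap hg₂ with hφ
  have key := congrArg (fun T : 𝓢'(E, ℂ) => T φ) (Lp.fourier_toTemperedDistribution_eq h)
  simp only [TemperedDistribution.fourier_apply, Lp.toTemperedDistribution_apply] at key
  have flip := VectorFourier.integral_fourierIntegral_smul_eq_flip (L := innerₗ E)
    Real.continuous_fourierChar continuous_inner (φ.integrable (μ := volume)) hi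
  calc _ = ∫ x, φ x • (𝓕 h : Lp ℂ 2 (volume : Measure E)) x := rfl
    _ = ∫ x, 𝓕 φ x • h x := key.symm
    _ = ∫ x, φ x • 𝓕 (h : E → ℂ) x := by
      rw [SchwartzMap.fourier_coe]
      refine flip.trans ?_
      rw [flip_innerₗ]
      rfl
    _ = _ := rfl

theorem memLp_indicator_fourierChar {s : Set E} (hs : MeasurableSet s) (hμ : volume s ≠ ∞)
    (ξ : E) : MemLp (s.indicator fun x => (Real.fourierChar (inner ℝ x ξ) : ℂ)) 2 volume := by
  have : IsFiniteMeasure ((volume : Measure E).restrict s) := ⟨by simpa using hμ.lt_top⟩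
  rw [memLp_indicator_iff_restrict hs]
  refine MemLp.of_bound (Continuous.aestronglyMeasurable ?_) 1 (.of_forall fun x => (Circle.norm_coe _).le)
  exact continuous_subtype_val.comp (Real.continuous_fourierChar.comp (continuous_id.inner continuous_const))

theorem norm_fourierChar_sub_le (a b : ℝ) :
    ‖(Real.fourierChar a : ℂ) - Real.fourierChar b‖ ≤ 2 * Real.pi * |a - b| := by
  have h : (Real.fourierChar a : ℂ) - Real.fourierChar b
      = Real.fourierChar b * ((Real.fourierChar (a - b) : ℂ) - 1) := by
    rw [mul_sub, mul_one, ← Circle.coe_mul, ← AddChar.map_add_eq_mul, add_sub_cancel]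
  rw [h, norm_mul, Circle.norm_coe, one_mul, Real.fourierChar_apply, mul_comm _ Complex.I]
  refine Real.norm_exp_I_mul_ofReal_sub_one_le.trans ?_
  rw [norm_mul, Real.norm_eq_abs, Real.norm_eq_abs, abs_of_pos Real.two_pi_pos]

/-- The plane wave of frequency `ξ`, cut off to the ball of radius `R`. -/
noncomputable def planeWave (R : ℝ) (ξ : E) : Lp ℂ 2 (volume : Measure E) :=
  (memLp_indicator_fourierChar (Metric.isOpen_ball (x := (0 : E)) (ε := R)).measurableSet
    measure_ball_lt_top.ne ξ).toLp _

theorem coeFn_planeWave (R : ℝ) (ξ : E) : planeWave R ξ =ᵐ[volume]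
    (Metric.ball (0 : E) R).indicator fun x => (Real.fourierChar (inner ℝ x ξ) : ℂ) :=
  MemLp.coeFn_toLp _

/-- The cutoff makes the map Lipschitz: on the ball, the phase changes with `ξ` at rate at most
`2π|R|`. -/
theorem continuous_planeWave (R : ℝ) : Continuous (planeWave R : E → Lp ℂ 2 volume) := by
  let χ : Lp ℂ 2 (volume : Measure E) := indicatorConstLp 2
    (Metric.isOpen_ball (x := (0 : E)) (ε := R)).measurableSet measure_ball_lt_top.ne 1
  refine (LipschitzWith.of_dist_le_mul (K := (2 * Real.pi * |R| * ‖χ‖).toNNReal)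
    fun ξ ζ => ?_).continuous
  rw [Real.coe_toNNReal _ (by positivity), dist_eq_norm, dist_eq_norm, mul_right_comm]
  refine Lp.norm_le_mul_norm_of_ae_le_mul ?_
  filter_upwards [Lp.coeFn_sub (planeWave R ξ) (planeWave R ζ), coeFn_planeWave R ξ,
    coeFn_planeWave R ζ, indicatorConstLp_coeFn (p := 2) (μ := (volume : Measure E))
    (hs := (Metric.isOpen_ball (x := (0 : E)) (ε := R)).measurableSet)
    (hμs := measure_ball_lt_top.ne) (c := (1 : ℂ))] with x h1 h2 h3 h4
  rw [h1, Pi.sub_apply, h2, h3, h4]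
  by_cases h : x ∈ Metric.ball (0 : E) R
  · simp only [Set.indicator_of_mem h, norm_one, mul_one]
    refine (norm_fourierChar_sub_le _ _).trans ?_
    rw [← inner_sub_right, mul_assoc (2 * Real.pi)]
    gcongr
    refine (abs_real_inner_le_norm _ _).trans ?_
    gcongr
    exact (mem_ball_zero_iff.1 h).le.trans (le_abs_self R)
  · simp [h]

theorem inner_planeWave (R : ℝ) (ξ : E) (u : Lp ℂ 2 (volume : Measure E)) :
    inner ℂ (planeWave R ξ) u = 𝓕 ((Metric.ball (0 : E) R).indicator u) ξ := by
  rw [L2.inner_def, Real.fourier_eq]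
  refine integral_congr_ae ?_
  filter_upwards [coeFn_planeWave R ξ] with x hx
  rw [hx]
  by_cases h : x ∈ Metric.ball (0 : E) R
  · simp [h, Circle.smul_def, mul_comm, AddChar.map_neg_eq_inv]
  · simp [h]

theorem eLpNorm_two_le_of_inner_planeWave_le {u : Lp ℂ 2 (volume : Measure E)} {R ρ η : ℝ}
    (h : ∀ ξ ∈ Metric.ball (0 : E) ρ, ‖inner ℂ (planeWave R ξ) u‖ ≤ η) :
    eLpNorm u 2 volume ≤
      eLpNorm (𝓕 u : Lp ℂ 2 (volume : Measure E)) 2 (volume.restrict (Metric.ball 0 ρ)ᶜ)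
      + eLpNorm u 2 (volume.restrict (Metric.ball 0 R)ᶜ)
      + volume (Metric.ball (0 : E) ρ) ^ (2⁻¹ : ℝ) * ENNReal.ofReal η := by
  have hρ : MeasurableSet (Metric.ball (0 : E) ρ) := Metric.isOpen_ball.measurableSet
  have hR : MeasurableSet (Metric.ball (0 : E) R) := Metric.isOpen_ball.measurableSet
  have hin : MemLp ((Metric.ball (0 : E) R).indicator u) 2 volume := (Lp.memLp u).indicator hR
  have hout : MemLp ((Metric.ball (0 : E) R)ᶜ.indicator u) 2 volume :=
    (Lp.memLp u).indicator hR.compl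
  have hsum : u = hin.toLp _ + hout.toLp _ := by
    rw [← MemLp.toLp_add]
    simp only [Set.indicator_self_add_compl, Lp.toLp_coeFn]
  -- On a ball of finite measure `L²` embeds in `L¹`, so the transform of the inner part is given by
  -- the integral.
  have hint : Integrable (hin.toLp _) := by
    rw [integrable_congr hin.coeFn_toLp, integrable_indicator_iff hR]
    have : IsFiniteMeasure ((volume : Measure E).restrict (Metric.ball 0 R)) :=
      ⟨by simpa using measure_ball_lt_top⟩
    exact ((Lp.memLp u).restrict _).integrable (by norm_num)
  have hFin : ∀ᵐ ξ ∂(volume.restrict (Metric.ball (0 : E) ρ)),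
      ‖(𝓕 (hin.toLp _) : Lp ℂ 2 (volume : Measure E)) ξ‖ ≤ η := by
    rw [ae_restrict_iff' hρ]
    filter_upwards [Lp.fourier_ae_eq _ hint] with ξ hξ hmem
    rw [hξ]
    convert h ξ hmem using 2
    rw [inner_planeWave, Real.fourier_eq, Real.fourier_eq]
    refine integral_congr_ae ?_
    filter_upwards [hin.coeFn_toLp] with x hx
    rw [hx]
  have hnorm : ∀ v : Lp ℂ 2 (volume : Measure E),
      eLpNorm (𝓕 v : Lp ℂ 2 (volume : Measure E)) 2 volume = eLpNorm v 2 volume := fun v => by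
    rw [← Lp.enorm_def, ← Lp.enorm_def, ← ofReal_norm, ← ofReal_norm, Lp.norm_fourier_eq]
  have hsplit : (𝓕 u : Lp ℂ 2 (volume : Measure E)) =ᵐ[volume]
      (𝓕 (hin.toLp _) : Lp ℂ 2 (volume : Measure E)) +
      (𝓕 (hout.toLp _) : Lp ℂ 2 (volume : Measure E)) := by
    conv_lhs => rw [hsum, FourierTransform.fourier_add]
    exact Lp.coeFn_add _ _
  calc eLpNorm u 2 volume = eLpNorm (𝓕 u : Lp ℂ 2 (volume : Measure E)) 2 volume := (hnorm u).symm
    _ = eLpNorm ((Metric.ball (0 : E) ρ)ᶜ.indicator (𝓕 u : Lp ℂ 2 (volume : Measure E)) +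
        (Metric.ball (0 : E) ρ).indicator (𝓕 u : Lp ℂ 2 (volume : Measure E))) 2 volume := by
      rw [Set.indicator_compl_add_self]
    _ ≤ eLpNorm (𝓕 u : Lp ℂ 2 (volume : Measure E)) 2 (volume.restrict (Metric.ball 0 ρ)ᶜ) +
        eLpNorm (𝓕 u : Lp ℂ 2 (volume : Measure E)) 2 (volume.restrict (Metric.ball 0 ρ)) := by
      rw [← eLpNorm_indicator_eq_eLpNorm_restrict hρ, ← eLpNorm_indicator_eq_eLpNorm_restrict hρ.compl]
      exact eLpNorm_add_le ((Lp.aestronglyMeasurable _).indicator hρ.compl)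
        ((Lp.aestronglyMeasurable _).indicator hρ) (by norm_num)
    _ ≤ _ := by
      rw [add_assoc]
      gcongr
      rw [eLpNorm_congr_ae (ae_restrict_of_ae hsplit), add_comm (eLpNorm u 2 _)]
      refine (eLpNorm_add_le (Lp.aestronglyMeasurable _).restrict
        (Lp.aestronglyMeasurable _).restrict (by norm_num)).trans (add_le_add ?_ ?_)
      · simpa using eLpNorm_le_of_ae_bound (p := 2) hFin
      · refine (eLpNorm_mono_measure _ Measure.restrict_le_self).trans ?_
        rw [hnorm, eLpNorm_congr_ae hout.coeFn_toLp,
          eLpNorm_indicator_eq_eLpNorm_restrict hR.compl]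

end Fourier

/-- The Jacobian `(2π)^d` of the dilation cancels the squared prefactor. -/
theorem setLIntegral_fourierL2 {d : ℕ} (f : Lp ℂ 2 (volume : Measure (EuclideanSpace ℝ (Fin d))))
    (ρ : ℝ) :
    ∫⁻ ξ in {ξ : EuclideanSpace ℝ (Fin d) | ρ ≤ ‖ξ‖}, ‖fourierL2 f ξ‖ₑ ^ 2 =
      ∫⁻ ξ in {ξ : EuclideanSpace ℝ (Fin d) | (2 * Real.pi)⁻¹ * ρ ≤ ‖ξ‖},
        ‖(𝓕 f : Lp ℂ 2 (volume : Measure (EuclideanSpace ℝ (Fin d)))) ξ‖ₑ ^ 2 := by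
  have hpi := Real.two_pi_pos
  set c : ℝ := (2 * Real.pi)⁻¹ with hc
  have hc0 : 0 < c := inv_pos.2 hpi
  have hpre : {ξ : EuclideanSpace ℝ (Fin d) | ρ ≤ ‖ξ‖} =
      (c • ·) ⁻¹' {ξ : EuclideanSpace ℝ (Fin d) | c * ρ ≤ ‖ξ‖} := by
    ext ξ
    simp [norm_smul, abs_of_pos hc0, hc0]
  have hemb : MeasurableEmbedding (fun ξ : EuclideanSpace ℝ (Fin d) => c • ξ) :=
    (Homeomorph.smulOfNeZero c hc0.ne').measurableEmbedding
  have hconst : ‖(((2 * Real.pi) ^ (-(d : ℝ) / 2) : ℝ) : ℂ)‖ₑ ^ 2 *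
      ENNReal.ofReal |(c ^ d)⁻¹| = 1 := by
    rw [← ofReal_norm, Complex.norm_real, Real.norm_of_nonneg (by positivity),
      ← ENNReal.ofReal_pow (by positivity), ← ENNReal.ofReal_mul (by positivity),
      abs_of_pos (by positivity), ← Real.rpow_natCast, ← Real.rpow_mul hpi.le, hc, inv_pow, inv_inv,
      ← Real.rpow_natCast, ← Real.rpow_add hpi]
    simp
  simp only [fourierL2, enorm_mul, mul_pow]
  rw [lintegral_const_mul' _ _ (by simp), hpre]
  change _ * ∫⁻ ξ in _, (fun η => ‖(𝓕 f : Lp ℂ 2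
    (volume : Measure (EuclideanSpace ℝ (Fin d)))) η‖ₑ ^ 2) (c • ξ) = _
  rw [← hemb.lintegral_map (fun η => ‖(𝓕 f : Lp ℂ 2
    (volume : Measure (EuclideanSpace ℝ (Fin d)))) η‖ₑ ^ 2), ← hemb.restrict_map, Measure.map_addHaar_smul _ hc0.ne',
    Measure.restrict_smul, lintegral_smul_measure, smul_eq_mul, ← mul_assoc,
    finrank_euclideanSpace_fin, hconst, one_mul]

theorem corollary3p2 (d : ℕ)
    (F : Set (Lp ℂ 2 (volume : Measure (EuclideanSpace ℝ (Fin d))))) (M : ℝ)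
    (hM : ∀ f ∈ F, ‖f‖ ≤ M)
    (hF : Tendsto
      (fun r : ℝ => ⨆ f ∈ F, ∫⁻ x in {x : EuclideanSpace ℝ (Fin d) | r ≤ ‖x‖}, ‖f x‖ₑ ^ 2)
      atTop (𝓝 0))
    (hFhat : Tendsto
      (fun ρ : ℝ => ⨆ f ∈ F,
        ∫⁻ ξ in {ξ : EuclideanSpace ℝ (Fin d) | ρ ≤ ‖ξ‖}, ‖fourierL2 f ξ‖ₑ ^ 2)
      atTop (𝓝 0)) :
    TotallyBounded F := by
  refine totallyBounded_of_forall_inner hM fun ε hε => ?_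
  have hcompl : ∀ r : ℝ, (Metric.ball (0 : EuclideanSpace ℝ (Fin d)) r)ᶜ = {x | r ≤ ‖x‖} :=
    fun r => by ext; simp
  -- Tails of `ε / 8` per function give `ε / 4` for a difference; two tails and the low-frequency
  -- term total `3ε / 4 < ε`.
  have htail : ∀ (v : EuclideanSpace ℝ (Fin d) → ℂ) (r : ℝ),
      ∫⁻ x in {x | r ≤ ‖x‖}, ‖v x‖ₑ ^ 2 < ENNReal.ofReal (ε / 8) ^ 2 →
      eLpNorm v 2 (volume.restrict (Metric.ball 0 r)ᶜ) ≤ ENNReal.ofReal (ε / 8) := by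
    intro v r h
    rw [hcompl, eLpNorm_eq_lintegral_rpow_enorm_toReal two_ne_zero ENNReal.ofNat_ne_top,
      one_div, ENNReal.rpow_inv_le_iff (by simp)]
    simpa using h.le
  have hpos : 0 < ENNReal.ofReal (ε / 8) ^ 2 := by positivity
  obtain ⟨R, hR⟩ := (hF.eventually_lt_const hpos).exists
  obtain ⟨ρ, hρ⟩ := (hFhat.eventually_lt_const hpos).exists
  set P : ℝ := (2 * Real.pi)⁻¹ * ρ
  have hRf : ∀ f ∈ F, eLpNorm f 2 (volume.restrict (Metric.ball 0 R)ᶜ) ≤ ENNReal.ofReal (ε / 8) :=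
    fun f hf => htail f R ((le_iSup₂ (f := fun (f : Lp ℂ 2
      (volume : Measure (EuclideanSpace ℝ (Fin d)))) (_ : f ∈ F) =>
        ∫⁻ x in {x : EuclideanSpace ℝ (Fin d) | R ≤ ‖x‖}, ‖f x‖ₑ ^ 2) f hf).trans_lt hR)
  have hPf : ∀ f ∈ F, eLpNorm (𝓕 f : Lp ℂ 2 (volume : Measure (EuclideanSpace ℝ (Fin d)))) 2
      (volume.restrict (Metric.ball 0 P)ᶜ) ≤ ENNReal.ofReal (ε / 8) := by
    refine fun f hf => htail _ P ?_
    rw [← setLIntegral_fourierL2]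
    exact (le_iSup₂ (f := fun (f : Lp ℂ 2
      (volume : Measure (EuclideanSpace ℝ (Fin d)))) (_ : f ∈ F) =>
        ∫⁻ ξ in {ξ : EuclideanSpace ℝ (Fin d) | ρ ≤ ‖ξ‖}, ‖fourierL2 f ξ‖ₑ ^ 2) f hf).trans_lt hρ
  have hsub : ∀ (f g : Lp ℂ 2 (volume : Measure (EuclideanSpace ℝ (Fin d))))
      (s : Set (EuclideanSpace ℝ (Fin d))), eLpNorm f 2 (volume.restrict s) ≤ ENNReal.ofReal (ε / 8) →
      eLpNorm g 2 (volume.restrict s) ≤ ENNReal.ofReal (ε / 8) →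
      eLpNorm (f - g : Lp ℂ 2 (volume : Measure (EuclideanSpace ℝ (Fin d)))) 2 (volume.restrict s) ≤
        ENNReal.ofReal (ε / 4) := by
    intro f g s hf hg
    rw [eLpNorm_congr_ae (ae_restrict_of_ae (Lp.coeFn_sub f g))]
    refine (eLpNorm_sub_le (Lp.aestronglyMeasurable f).restrict
      (Lp.aestronglyMeasurable g).restrict (by norm_num)).trans ((add_le_add hf hg).trans_eq ?_)
    rw [← ENNReal.ofReal_add (by positivity) (by positivity)]
    congr 1
    ring
  set V : ℝ≥0∞ := volume (Metric.ball (0 : EuclideanSpace ℝ (Fin d)) P) ^ (2⁻¹ : ℝ) with hV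
  have hVtop : V ≠ ∞ := ENNReal.rpow_ne_top_of_nonneg (by norm_num) measure_ball_lt_top.ne
  -- The closed ball gives compactness. The `+ 1` covers `V = 0`, which occurs when `P ≤ 0`.
  refine ⟨planeWave R '' Metric.closedBall 0 P,
    ((isCompact_closedBall _ _).image (continuous_planeWave R)).totallyBounded,
    ε / (4 * (V.toReal + 1)), by positivity, fun f hf g hg h => ?_⟩
  have key := eLpNorm_two_le_of_inner_planeWave_le (u := f - g) (R := R) (ρ := P)
    fun ξ hξ => h _ ⟨ξ, Metric.ball_subset_closedBall hξ, rfl⟩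
  rw [show 𝓕 (f - g) = 𝓕 f - 𝓕 g from (Lp.fourierTransformₗᵢ _ _).map_sub f g, ← hV, ← ENNReal.ofReal_toReal hVtop,
    ← ENNReal.ofReal_mul ENNReal.toReal_nonneg] at key
  have key' := key.trans (add_le_add (add_le_add (hsub _ _ _ (hPf f hf) (hPf g hg))
    (hsub _ _ _ (hRf f hf) (hRf g hg))) le_rfl)
  rw [← Lp.enorm_def, ← ofReal_norm, ← ENNReal.ofReal_add (by positivity) (by positivity),
    ← ENNReal.ofReal_add (by positivity) (by positivity),
    ENNReal.ofReal_le_ofReal_iff (by positivity)] at key'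
  rw [ENNReal.ofReal_toReal hVtop] at key'
  rw [dist_eq_norm]
  have hlast : V.toReal * (ε / (4 * (V.toReal + 1))) ≤ ε / 4 := by
    rw [mul_div_assoc', div_le_div_iff₀ (by positivity) (by positivity)]
    nlinarith [ENNReal.toReal_nonneg (a := V)]
  linarith
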